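/- Let $M$ be a nonempty compact smooth Riemannian manifold (boundary and corners are allowed) with Riemannian distance $d$ (equal to $\infty$ between different connected components). For a continuous $g:M\to M$, $\Lambda\subset M$, $\varepsilon>0$, $n\ge 1$, let $B_n(g,x,\varepsilon)=\{y: d(g^iy,g^ix)<\varepsilon,\ 0\le i<n\}$ and let $r_n(g,\Lambda,\varepsilon)$ be the least cardinality of a set $K\subset M$ such that every $x\in\Lambda$ lies in $B_n(g,y,\varepsilon)$ for some $y\in K$; put $r_n(g,\varepsilon)=r_n(g,M,\varepsilon)$, $h(g,\varepsilon)=\limsup_{n}\frac1n\log r_n(g,\varepsilon)$ and let $h(g)=\lim_{\varepsilon\to0}h(g,\varepsilon)$ be the topological entropy. For a $g$-invariant Borel probability measure $\mu$ put $$h_{\rm loc}(\mu,\varepsilon)=\lim_{\sigma\to1,\ \sigma<1}\ \inf_{F\text{ Borel},\ \mu(F)\ge\sigma}\ \lim_{\delta\to0}\limsup_{n\to\infty}\frac1n\log\sup_{x\in F}r_n\big(g,F\cap B_n(g,x,\varepsilon),\delta\big),$$ and $h_{\rm loc}(g,\varepsilon)=\sup_\mu h_{\rm loc}(\mu,\varepsilon)$,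 the supremum being over all such $\mu$. Let $f:M\to M$ be continuous and let $G$ be a set of continuous, everywhere differentiable maps $M\to M$ such that $h^G_{\rm loc}(\varepsilon):=\sup_{g\in G}h_{\rm loc}(g,\varepsilon)\to0$ as $\varepsilon\to0^+$ and $M_0(G):=\sup_{g\in G}\max(\|Dg\|_\infty,2)<\infty$, where $\|Dg\|_\infty=\sup_{x}\|D_xg\|$ is taken for the Riemannian norms. For $\eta>0$ let $p_\eta$ be the least integer $p\ge1$ with $$\frac1{p}\log r_{p}(f,\eta/4)-h(f,\eta/4)\le h^G_{\rm loc}(\eta),$$ with $p_\eta=\infty$ if there is none, and put $\delta(\eta)=\frac{\eta}{4}M_0(G)^{-p_\eta}$ (so $\delta(\eta)=0$ if $p_\eta=\infty$). Write $d(g,f)=\sup_{x\in M}d(gx,fx)$. Then: 1. for every $\eta>0$ with $h^G_{\rm loc}(\eta)>0$ the integer $p_\eta$ exists; 2. for every $\varepsilon>0$ for which there is a smallest positive real number $N(\varepsilon)$ with $\delta(N(\varepsilon))=\varepsilon$, and every $g\in G$ with $d(g,f)\le\varepsilon$, $$h(g)\le h(f)+2h^G_{\rm loc}(N(\varepsilon));$$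 3. more generally, for every $\varepsilon>0$, every $\eta>0$ with $\varepsilon\le\delta(\eta)$ and every $g\in G$ with $d(g,f)\le\varepsilon$, $$h(g)\le h(f)+2h^G_{\rm loc}(\eta).$$ -/

import Mathlib

open Set Filter Topology MeasureTheory Bundle
open scoped ENNReal ContDiff Manifold

noncomputable section

namespace LocalEntropy

/-- The set of pairs of points at distance `< ε`. -/
def near (M : Type*) [EMetricSpace M] (ε : ℝ) : SetRel M M :=
  {q : M × M | edist q.1 q.2 < ENNReal.ofReal ε}

/-- `B_n(g, x, ε)`, the `n`-step dynamical ball. -/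
def dynBall {M : Type*} [EMetricSpace M] (g : M → M) (n : ℕ) (x : M) (ε : ℝ) : Set M :=
  {y : M | ∀ i < n, edist (g^[i] y) (g^[i] x) < ENNReal.ofReal ε}

/-- `r_n(g, Λ, ε)`: the least cardinality of a subset of `M` that is `(n, ε)`-spanning for `Λ`. -/
def spanCard {M : Type*} [EMetricSpace M] (g : M → M) (Λ : Set M) (ε : ℝ) (n : ℕ) : ℝ≥0∞ :=
  ((Dynamics.coverMincard g Λ (near M ε) n : ℕ∞) : ℝ≥0∞)

/-- `h(g, ε) = limsup_n (1/n) log r_n(g, M, ε)`. -/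
def scaleEntropy {M : Type*} [EMetricSpace M] (g : M → M) (ε : ℝ) : EReal :=
  Dynamics.coverEntropyEntourage g univ (near M ε)

/-- The topological entropy `h(g) = lim_{ε → 0} h(g, ε)`. As `h(g, ε)` increases when `ε`
decreases, the limit is a supremum, which Mathlib takes over all entourages. -/
def topEntropy {M : Type*} [EMetricSpace M] (g : M → M) : EReal :=
  Dynamics.coverEntropy g univ

/-- `lim_{δ → 0} limsup_n (1/n) log sup_{x ∈ F} r_n(g, F ∩ B_n(g, x, ε), δ)`; the quantity
increases when `δ` decreases, so the limit is a supremum. -/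
def localEntropyOn {M : Type*} [EMetricSpace M] (g : M → M) (F : Set M) (ε : ℝ) : EReal :=
  ⨆ (δ : ℝ) (_ : 0 < δ), ExpGrowth.expGrowthSup
    (fun n : ℕ ↦ ⨆ x ∈ F, spanCard g (F ∩ dynBall g n x ε) δ n)

/-- `h_loc(μ, ε) = lim_{σ → 1, σ < 1} inf_{F, μ(F) ≥ σ} (...)`; the infimum increases with `σ`,
so the limit is a supremum. -/
def localEntropyMeasure {M : Type*} [EMetricSpace M] [MeasurableSpace M] (g : M → M)
    (μ : Measure M) (ε : ℝ) : EReal :=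
  ⨆ (σ : ℝ≥0∞) (_ : σ < 1), ⨅ (F : Set M) (_ : MeasurableSet F) (_ : σ ≤ μ F),
    localEntropyOn g F ε

/-- `h_loc(g, ε)`: the supremum of `h_loc(μ, ε)` over the `g`-invariant Borel probability
measures. -/
def localEntropy {M : Type*} [EMetricSpace M] [MeasurableSpace M] (g : M → M) (ε : ℝ) : EReal :=
  ⨆ (μ : Measure M) (_ : IsProbabilityMeasure μ) (_ : MeasurePreserving g μ μ),
    localEntropyMeasure g μ ε

/-- `h_loc^G(ε) = sup_{g ∈ G} h_loc(g, ε)`. -/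
def localEntropySup {M : Type*} [EMetricSpace M] [MeasurableSpace M] (G : Set C(M, M))
    (ε : ℝ) : EReal :=
  ⨆ g ∈ G, localEntropy g ε

/-- `M_0(G) = sup_{g ∈ G} max(‖Dg‖_∞, 2)`, a value in `[0, ∞]`; the norm of `D_x g` is the
operator norm for the Riemannian norms of the tangent spaces at `x` and `g x`. -/
def derivBound {E : Type*} [NormedAddCommGroup E] [NormedSpace ℝ E] {H : Type*}
    [TopologicalSpace H] (I : ModelWithCorners ℝ E H) {M : Type*} [EMetricSpace M]
    [ChartedSpace H M] [IsManifold I ∞ M] [RiemannianBundle (fun x : M ↦ TangentSpace I x)]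
    [IsContMDiffRiemannianBundle I ∞ E (fun x : M ↦ TangentSpace I x)]
    (G : Set C(M, M)) : ℝ≥0∞ :=
  ⨆ g ∈ G, max (⨆ x : M, ‖mfderiv I I g x‖ₑ) 2

/-- The integers `p ≥ 1` such that
`(1/p) log r_p(f, ε/4) - h(f, ε/4) ≤ h_loc^G(ε)`. -/
def goodTimes {M : Type*} [EMetricSpace M] [MeasurableSpace M] (f : C(M, M)) (G : Set C(M, M))
    (ε : ℝ) : Set ℕ :=
  {p : ℕ | 1 ≤ p ∧
    ENNReal.log (spanCard f univ (ε / 4) p) / (p : EReal) - scaleEntropy f (ε / 4)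
      ≤ localEntropySup G ε}

/-- The least integer `p_ε` of `goodTimes`, meaningful when there is one. -/
def leastTime {M : Type*} [EMetricSpace M] [MeasurableSpace M] (f : C(M, M)) (G : Set C(M, M))
    (ε : ℝ) : ℕ :=
  sInf (goodTimes f G ε)

open Classical in
/-- The function `ε ↦ (ε/4) M_0(G)^(-p_ε)`. Where no `p_ε` exists (that is, `p_ε = ∞`), the value
is `0`. -/
def closeness {E : Type*} [NormedAddCommGroup E] [NormedSpace ℝ E] {H : Type*}
    [TopologicalSpace H] (I : ModelWithCorners ℝ E H) {M : Type*} [EMetricSpace M]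
    [MeasurableSpace M] [ChartedSpace H M] [IsManifold I ∞ M]
    [RiemannianBundle (fun x : M ↦ TangentSpace I x)]
    [IsContMDiffRiemannianBundle I ∞ E (fun x : M ↦ TangentSpace I x)]
    (f : C(M, M)) (G : Set C(M, M)) (ε : ℝ) : ℝ :=
  if (goodTimes f G ε).Nonempty then
    ε / 4 * ((derivBound I G).toReal ^ leastTime f G ε)⁻¹
  else 0

end LocalEntropy

end

/-! Entropy is bounded through codes: finitely many symbols such that points with equal symbols have
close orbits for a given time. The central estimate (`topEntropy_le_add_localEntropy`) says that if
R symbols code all g-orbits over p steps at scale η, then h(g) ≤ (log R)/p + h_loc(g, η).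

To prove it, take a < h(g) and nets of at least e^(an) points at infinitely many times n. Their
empirical measures accumulate at an invariant probability measure μ. The definition of h_loc
provides a set F of almost full μ-measure in which each η-cell of the code refines cheaply to an
arbitrarily small scale. Covering F by small dynamical balls gives an open U ⊇ F, and openness
passes the lower bound on measure back to the empirical measures. By Markov's inequality, at least
half of the net points seldom leave U. Such orbits are coded by long blocks started in U and single
steps outside it (`orbitCodable_badCount_le`); comparing the number of codes with e^(an) bounds a.

The comparison with f is elementary. A mean value inequality along curves makes g Lipschitz with
constant M_0(G), so over p_η steps the orbits of f and g separate by at most η/4. A code of f at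
scale η/2 is then a code of g at scale η, and the choice of p_η bounds its rate by h(f) +
h_loc^G(η). The second h_loc^G(η) comes from the central estimate. -/

namespace LocalEntropy

/-! ### Mean value inequality for the Riemannian distance. -/

section Speed

open Manifold NNReal Metric

/-- A fencing principle for curves in an extended metric space: a curve whose metric speed is
controlled by the derivative of `B` travels at most the increment of `B`. -/
theorem edist_le_of_eventually_edist_le {M : Type*} [PseudoEMetricSpace M] {c : ℝ → M}
    (hc : Continuous c) {B b : ℝ → ℝ} (hB : ∀ t, HasDerivAt B (b t) t) (hB0 : B 0 = 0)
    (hb : ∀ t, 0 ≤ b t)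
    (h : ∀ t κ, b t < κ → ∀ᶠ u in 𝓝[>] t, edist (c t) (c u) ≤ ENNReal.ofReal (κ * (u - t))) :
    edist (c 0) (c 1) ≤ ENNReal.ofReal (B 1) := by
  have hBc : Continuous B := continuous_iff_continuousAt.2 fun t ↦ (hB t).continuousAt
  have hBmono : Monotone B := monotone_of_hasDerivAt_nonneg hB hb
  have key : ∀ ε : ℝ, 0 < ε → edist (c 0) (c 1) ≤ ENNReal.ofReal (B 1 + ε) := by
    intro ε hε
    -- The slack ε t propagates to the right: half of ε absorbs the excess speed of c, half the
    -- error in the slope of B.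
    let s : Set ℝ := {t | edist (c 0) (c t) ≤ ENNReal.ofReal (B t + ε * t)}
    have hs : IsClosed s := isClosed_le (continuous_const.edist hc)
      (ENNReal.continuous_ofReal.comp (by fun_prop))
    have hsub : Icc (0 : ℝ) 1 ⊆ s := by
      refine (hs.inter isClosed_Icc).Icc_subset_of_forall_exists_gt (by simp [s]) ?_
      rintro t ⟨ht, ht0, ht1⟩ y hy
      have h1 := h t (b t + ε / 2) (by linarith)
      have h2 : ∀ᶠ u in 𝓝[>] t, b t - ε / 2 < slope B t u :=
        ((hasDerivAt_iff_tendsto_slope.1 (hB t)).mono_left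
          (nhdsWithin_mono _ fun u (hu : t < u) ↦ hu.ne')).eventually
          (lt_mem_nhds (by linarith))
      have h3 : ∀ᶠ u in 𝓝[>] t, u ∈ Ioc t y := Ioc_mem_nhdsGT hy
      obtain ⟨u, hu1, hu2, hu3⟩ := (h1.and (h2.and h3)).exists
      refine ⟨u, ?_, hu3⟩
      have hut : 0 < u - t := sub_pos.2 hu3.1
      rw [slope_def_field, lt_div_iff₀ hut] at hu2
      have hBt : 0 ≤ B t := hB0 ▸ hBmono ht0
      calc edist (c 0) (c u) ≤ edist (c 0) (c t) + edist (c t) (c u) := edist_triangle _ _ _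
        _ ≤ ENNReal.ofReal (B t + ε * t) + ENNReal.ofReal ((b t + ε / 2) * (u - t)) :=
            add_le_add ht hu1
        _ = ENNReal.ofReal (B t + ε * t + (b t + ε / 2) * (u - t)) := by
            have := hb t
            exact (ENNReal.ofReal_add (by positivity) (by positivity)).symm
        _ ≤ ENNReal.ofReal (B u + ε * u) := by
            apply ENNReal.ofReal_le_ofReal
            nlinarith
    simpa [s] using hsub (right_mem_Icc.2 zero_le_one)
  have hlim : Tendsto (fun ε : ℝ ↦ ENNReal.ofReal (B 1 + ε)) (𝓝[>] 0)
      (𝓝 (ENNReal.ofReal (B 1 + 0))) :=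
    ((ENNReal.continuous_ofReal.comp (continuous_const.add continuous_id)).tendsto 0).mono_left
      nhdsWithin_le_nhds
  rw [add_zero] at hlim
  exact ge_of_tendsto hlim (by filter_upwards [self_mem_nhdsWithin] with ε hε using key ε hε)

/-- The trivialization of the tangent bundle at `x` inverts its own inverse over `x`. -/
theorem continuousLinearMapAt_symmL_self {E : Type*} [NormedAddCommGroup E] [NormedSpace ℝ E]
    {H : Type*} [TopologicalSpace H] (I : ModelWithCorners ℝ E H) {M : Type*}
    [TopologicalSpace M] [ChartedSpace H M] [IsManifold I 1 M] (x : M) (w : E) :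
    (trivializationAt E (TangentSpace I) x).continuousLinearMapAt ℝ x
      ((trivializationAt E (TangentSpace I) x).symmL ℝ x w) = w :=
  (trivializationAt E (TangentSpace I) x).continuousLinearMapAt_symmL
    (FiberBundle.mem_baseSet_trivializationAt' x) w

theorem symmL_continuousLinearMapAt_self {E : Type*} [NormedAddCommGroup E] [NormedSpace ℝ E]
    {H : Type*} [TopologicalSpace H] (I : ModelWithCorners ℝ E H) {M : Type*}
    [TopologicalSpace M] [ChartedSpace H M] [IsManifold I 1 M] (x : M) (v : TangentSpace I x) :
    (trivializationAt E (TangentSpace I) x).symmL ℝ x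
      ((trivializationAt E (TangentSpace I) x).continuousLinearMapAt ℝ x v) = v :=
  (trivializationAt E (TangentSpace I) x).symmL_continuousLinearMapAt
    (FiberBundle.mem_baseSet_trivializationAt' x) v

section Riemannian

variable {E : Type*} [NormedAddCommGroup E] [NormedSpace ℝ E] {H : Type*} [TopologicalSpace H]
  (I : ModelWithCorners ℝ E H) {M : Type*} [TopologicalSpace M] [ChartedSpace H M]
  [RiemannianBundle (fun x : M ↦ TangentSpace I x)] [IsManifold I 1 M]
  [IsContinuousRiemannianBundle E (fun x : M ↦ TangentSpace I x)]

/-- The derivative of the inverse chart is the inverse trivialization at the moving point. The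
metric is continuous, so replacing that point by x costs a factor as close to 1 as desired. -/
theorem eventually_enorm_mfderivWithin_symm_extChartAt_le (x : M) {r : ℝ≥0} (hr : 1 < r) :
    ∀ᶠ z in 𝓝[range I] (extChartAt I x x), ∀ w : E,
      ‖(mfderivWithin 𝓘(ℝ, E) I (extChartAt I x).symm (range I) z w :
          TangentSpace I ((extChartAt I x).symm z))‖ₑ ≤
        r * ‖(trivializationAt E (TangentSpace I) x).symmL ℝ x w‖ₑ := by
  have hC : ∀ᶠ y in 𝓝 x, ∀ w : E,
      ‖(trivializationAt E (TangentSpace I) x).symmL ℝ y w‖ₑ ≤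
        r * ‖(trivializationAt E (TangentSpace I) x).symmL ℝ x w‖ₑ := by
    filter_upwards [eventually_norm_symmL_trivializationAt_comp_self_lt E
      (fun x : M ↦ TangentSpace I x) x (r := r) (by exact_mod_cast hr)] with y hy w
    have h := ContinuousLinearMap.le_of_opNorm_le _ hy.le
      ((trivializationAt E (TangentSpace I) x).symmL ℝ x w)
    rw [ContinuousLinearMap.comp_apply, continuousLinearMapAt_symmL_self] at h
    simp only [enorm, nnnorm]
    exact_mod_cast h
  have hx : 𝓝 x = 𝓝 ((extChartAt I x).symm (extChartAt I x x)) := by simp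
  rw [hx] at hC
  have hcont : ContinuousAt (extChartAt I x).symm (extChartAt I x x) :=
    continuousAt_extChartAt_symm _
  filter_upwards [nhdsWithin_le_nhds (hcont.preimage_mem_nhds hC),
    extChartAt_target_mem_nhdsWithin x] with z hz hzt w
  have hsource : (extChartAt I x).symm z ∈ (chartAt H x).source := by
    simpa using (extChartAt I x).map_target hzt
  have hsymm := TangentBundle.symmL_trivializationAt (I := I) hsource
  rw [(extChartAt I x).right_inv hzt] at hsymm
  have hzw := hz w
  rw [hsymm] at hzw
  exact hzw

/-- To first order, the Riemannian distance is at most the norm of the difference in a chart. -/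
theorem eventually_riemannianEDist_le_enorm_symmL (x : M) {r : ℝ≥0} (hr : 1 < r) :
    ∀ᶠ y in 𝓝 x, riemannianEDist I x y ≤ r *
      ‖(trivializationAt E (TangentSpace I) x).symmL ℝ x
        (extChartAt I x y - extChartAt I x x : E)‖ₑ := by
  obtain ⟨ρ, ρ_pos, hρ⟩ := mem_nhdsWithin_iff.1 (inter_mem
    (extChartAt_target_mem_nhdsWithin (I := I) x)
    (eventually_enorm_mfderivWithin_symm_extChartAt_le I x hr))
  have A : (extChartAt I x) ⁻¹' (ball (extChartAt I x x) ρ ∩ range I) ∈ 𝓝 x := by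
    apply extChartAt_preimage_mem_nhds_of_mem_nhdsWithin (by simp)
    rw [inter_comm]
    exact inter_mem_nhdsWithin _ (ball_mem_nhds _ ρ_pos)
  filter_upwards [A, chart_source_mem_nhds H x] with y hy h'y
  let η := ContinuousAffineMap.lineMap (R := ℝ) (extChartAt I x x) (extChartAt I x y)
  set γ := (extChartAt I x).symm ∘ η
  have hη : Icc 0 1 ⊆ ⇑η ⁻¹' ((extChartAt I x).target ∩ {z | ∀ w : E,
      ‖(mfderivWithin 𝓘(ℝ, E) I (extChartAt I x).symm (range I) z w :
          TangentSpace I ((extChartAt I x).symm z))‖ₑ ≤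
        r * ‖(trivializationAt E (TangentSpace I) x).symmL ℝ x w‖ₑ}) := by
    simp only [← image_subset_iff, ContinuousAffineMap.coe_lineMap_eq,
     ← segment_eq_image_lineMap, η]
    apply Subset.trans _ hρ
    -- Convexity of `range I` keeps the segment in the chart's image also at boundary and corner
    -- points.
    exact ((convex_ball _ _).inter I.convex_range).segment_subset (by simp [ρ_pos]) hy
  simp only [preimage_inter, subset_inter_iff] at hη
  have η_smooth : CMDiff[Icc 0 1] 1 η := by
    apply ContMDiff.contMDiffOn
    rw [contMDiff_iff_contDiff]
    exact ContinuousAffineMap.contDiff _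
  have : riemannianEDist I x y ≤ pathELength I γ 0 1 := by
    apply riemannianEDist_le_pathELength _ _ _ zero_le_one
    · exact (contMDiffOn_extChartAt_symm x).comp η_smooth hη.1
    · simp [γ, η, ContinuousAffineMap.coe_lineMap_eq]
    · simp [γ, η, ContinuousAffineMap.coe_lineMap_eq, h'y]
  apply this.trans
  have hconst : r * ‖(trivializationAt E (TangentSpace I) x).symmL ℝ x
        (extChartAt I x y - extChartAt I x x : E)‖ₑ = ∫⁻ t in Icc (0 : ℝ) 1, r *
        ‖(trivializationAt E (TangentSpace I) x).symmL ℝ x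
        (extChartAt I x y - extChartAt I x x : E)‖ₑ := by simp
  rw [hconst, pathELength_eq_lintegral_mfderivWithin_Icc]
  apply setLIntegral_mono' measurableSet_Icc (fun t ht ↦ ?_)
  have h1 : mfderiv[Icc 0 1] γ t =
      (mfderiv[range I] (extChartAt I x).symm (η t)) ∘L (mfderiv[Icc 0 1] η t) := by
    apply mfderivWithin_comp
    · exact mdifferentiableWithinAt_extChartAt_symm (hη.1 ht)
    · exact η_smooth.mdifferentiableOn one_ne_zero t ht
    · exact hη.1.trans (preimage_mono (extChartAt_target_subset_range x))
    · rw [uniqueMDiffWithinAt_iff_uniqueDiffWithinAt]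
      exact uniqueDiffOn_Icc zero_lt_one t ht
  have h2 : mfderiv[Icc 0 1] γ t 1 =
      (mfderiv[range I] (extChartAt I x).symm (η t)) (mfderiv[Icc 0 1] η t 1) := congr($h1 1)
  have h3 : (mfderiv[Icc 0 1] η t 1 : E) = extChartAt I x y - extChartAt I x x := by
    have h := (AffineMap.hasDerivAt_lineMap (a := extChartAt I x x) (b := extChartAt I x y)
      (x := t)).hasFDerivAt.hasFDerivWithinAt.fderivWithin (uniqueDiffOn_Icc zero_lt_one t ht)
    rw [mfderivWithin_eq_fderivWithin]
    change fderivWithin ℝ (AffineMap.lineMap (extChartAt I x x) (extChartAt I x y)) _ _ (1 : ℝ) = _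
    rw [h]
    simp
  rw [h2]
  have h4 := hη.2 ht (mfderiv[Icc 0 1] η t 1)
  rw [h3] at h4 ⊢
  exact h4

/-- The metric speed of a differentiable curve is at most the norm of its derivative. -/
theorem eventually_riemannianEDist_curve_le {c : ℝ → M} {t κ : ℝ}
    (hc : MDifferentiableAt 𝓘(ℝ, ℝ) I c t)
    (hκ : ‖(mfderiv 𝓘(ℝ, ℝ) I c t (1 : ℝ) : TangentSpace I (c t))‖ < κ) :
    ∀ᶠ u in 𝓝 t, riemannianEDist I (c t) (c u) ≤ ENNReal.ofReal (κ * |u - t|) := by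
  set v : TangentSpace I (c t) := mfderiv 𝓘(ℝ, ℝ) I c t (1 : ℝ) with hv
  set S := (trivializationAt E (TangentSpace I) (c t)).symmL ℝ (c t) with hS
  -- The room below κ is split: m bounds the difference quotients in the chart, and r = κ / m > 1
  -- bounds the metric distortion.
  obtain ⟨m, hvm, hmκ⟩ := exists_between hκ
  have hm : 0 < m := (norm_nonneg v).trans_lt hvm
  have hr : 1 < κ / m := (one_lt_div hm).2 hmκ
  let r : ℝ≥0 := ⟨κ / m, by linarith⟩
  have h1 : ∀ᶠ u in 𝓝 t, riemannianEDist I (c t) (c u) ≤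
      r * ‖S (extChartAt I (c t) (c u) - extChartAt I (c t) (c t) : E)‖ₑ :=
    hc.continuousAt.eventually (eventually_riemannianEDist_le_enorm_symmL I (c t) (r := r) hr)
  have h2 : HasMFDerivAt 𝓘(ℝ, ℝ) 𝓘(ℝ, E) (extChartAt I (c t) ∘ c) t
      ((mfderiv I 𝓘(ℝ, E) (extChartAt I (c t)) (c t)).comp (mfderiv 𝓘(ℝ, ℝ) I c t)) :=
    HasMFDerivAt.comp t (mdifferentiableAt_extChartAt (mem_chart_source H (c t))).hasMFDerivAt
      hc.hasMFDerivAt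
  have h3 : HasDerivAt (fun u ↦ extChartAt I (c t) (c u))
      ((trivializationAt E (TangentSpace I) (c t)).continuousLinearMapAt ℝ (c t) v) t := by
    let L : ℝ →L[ℝ] E :=
      (mfderiv I 𝓘(ℝ, E) (extChartAt I (c t)) (c t)).comp (mfderiv 𝓘(ℝ, ℝ) I c t)
    have h' : HasFDerivAt (extChartAt I (c t) ∘ c) L t := h2.hasFDerivAt
    have h := h'.hasDerivAt
    rw [TangentBundle.continuousLinearMapAt_trivializationAt (mem_chart_source H (c t))]
    exact h
  have h4 : HasDerivAt (fun u ↦ S (extChartAt I (c t) (c u))) v t := by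
    have h := S.hasFDerivAt.comp_hasDerivAt t h3
    rwa [hS, symmL_continuousLinearMapAt_self] at h
  have h5 := h4.hasDerivWithinAt.limsup_norm_slope_le (s := univ) hvm
  rw [nhdsWithin_univ] at h5
  filter_upwards [h1, h5] with u hu1 hu2
  refine hu1.trans ?_
  rcases eq_or_ne u t with rfl | hut
  · simp
  have hut' : 0 < ‖u - t‖ := norm_pos_iff.2 (sub_ne_zero.2 hut)
  rw [inv_mul_lt_iff₀ hut', ← map_sub] at hu2
  have hrm : κ * |u - t| = κ / m * (|u - t| * m) := by field_simp
  rw [hrm, ENNReal.ofReal_mul (by linarith), ← ofReal_norm]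
  exact mul_le_mul' (ENNReal.ofReal_eq_coe_nnreal (by positivity)).ge
    (ENNReal.ofReal_le_ofReal hu2.le)

/-- The speed of a `C^1` curve is continuous. -/
theorem continuous_norm_mfderiv_curve {γ : ℝ → M} (hγ : ContMDiff 𝓘(ℝ, ℝ) I 1 γ) :
    Continuous fun t ↦ ‖(mfderiv 𝓘(ℝ, ℝ) I γ t (1 : ℝ) : TangentSpace I (γ t))‖ := by
  have h1 : Continuous fun t : ℝ ↦
      (⟨γ t, mfderiv 𝓘(ℝ, ℝ) I γ t (1 : ℝ)⟩ : TotalSpace E (TangentSpace I : M → Type _)) := by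
    have h2 : Continuous fun t : ℝ ↦ (⟨t, (1 : ℝ)⟩ : TangentBundle 𝓘(ℝ, ℝ) ℝ) :=
      (tangentBundleModelSpaceHomeomorph 𝓘(ℝ, ℝ)).symm.continuous.comp
        (continuous_id.prodMk continuous_const)
    exact (hγ.continuous_tangentMap le_rfl).comp h2
  have h3 := h1.inner_bundle h1
  simp only [real_inner_self_eq_norm_sq] at h3
  simpa using h3.sqrt

end Riemannian

/-- A differentiable map of a Riemannian manifold whose derivative has norm at most `C` is
`C`-Lipschitz for the Riemannian distance. -/
theorem lipschitzWith_of_enorm_mfderiv_le {E : Type*} [NormedAddCommGroup E] [NormedSpace ℝ E]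
    {H : Type*} [TopologicalSpace H] (I : ModelWithCorners ℝ E H) {M : Type*}
    [PseudoEMetricSpace M] [ChartedSpace H M] [RiemannianBundle (fun x : M ↦ TangentSpace I x)]
    [IsManifold I 1 M] [IsContinuousRiemannianBundle E (fun x : M ↦ TangentSpace I x)]
    [IsRiemannianManifold I M] {g : M → M} (hg : MDifferentiable I I g) {C : ℝ≥0} (hC : C ≠ 0)
    (hgC : ∀ x, ‖mfderiv I I g x‖ₑ ≤ C) : LipschitzWith C g := by
  intro x y
  rcases eq_or_ne (edist x y) ⊤ with hxy | hxy
  · simp [hxy, hC]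
  refine ENNReal.le_of_forall_pos_le_add fun ε hε hlt ↦ ?_
  have hr : riemannianEDist I x y < edist x y + (ε / C : ℝ≥0) := by
    rw [← IsRiemannianManifold.out (I := I) x y]
    exact ENNReal.lt_add_right hxy (by simp [hε.ne', hC])
  -- This almost minimizing curve is C¹ on all of ℝ, so its speed is continuous there and has a
  -- primitive differentiable everywhere.
  obtain ⟨γ, hγx, hγy, hγ, hlen, -⟩ :=
    exists_lt_locally_constant_of_riemannianEDist_lt hr zero_lt_one
  have hφ := continuous_norm_mfderiv_curve I hγ
  set φ : ℝ → ℝ := fun t ↦ ‖(mfderiv 𝓘(ℝ, ℝ) I γ t (1 : ℝ) : TangentSpace I (γ t))‖ with hφdef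
  have hγd : MDifferentiable 𝓘(ℝ, ℝ) I γ := hγ.mdifferentiable one_ne_zero
  have hB : ∀ t, HasDerivAt (fun t ↦ ∫ s in (0 : ℝ)..t, C * φ s) (C * φ t) t := fun t ↦
    (by fun_prop : Continuous fun t ↦ C * φ t).integral_hasStrictDerivAt 0 t |>.hasDerivAt
  -- The curve g ∘ γ is differentiable but perhaps not C¹, so it is fenced by the primitive of C φ
  -- instead of being measured by its length.
  have key := edist_le_of_eventually_edist_le (c := g ∘ γ)
    (hg.continuous.comp hγ.continuous) hB (by simp) (fun t ↦ by positivity) ?_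
  · simp only [Function.comp_apply, hγx, hγy] at key
    have hlen' : ENNReal.ofReal (∫ s in (0 : ℝ)..1, φ s) = pathELength I γ 0 1 := by
      rw [intervalIntegral.integral_of_le zero_le_one, ← integral_Icc_eq_integral_Ioc,
        ofReal_integral_eq_lintegral_ofReal hφ.continuousOn.integrableOn_Icc
          (ae_of_all _ fun _ ↦ norm_nonneg _), pathELength_eq_lintegral_mfderiv_Icc]
      exact lintegral_congr fun t ↦ ofReal_norm _
    rw [intervalIntegral.integral_const_mul, ENNReal.ofReal_mul (by positivity), hlen'] at key
    calc edist (g x) (g y) ≤ ENNReal.ofReal C * (edist x y + (ε / C : ℝ≥0)) :=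
          key.trans (by gcongr)
      _ = C * edist x y + ε := by
          rw [ENNReal.ofReal_coe_nnreal, mul_add, ← ENNReal.coe_mul, mul_div_cancel₀ _ hC]
  · intro t κ hκ
    have hd : MDifferentiableAt 𝓘(ℝ, ℝ) I (g ∘ γ) t := (hg (γ t)).comp t (hγd t)
    have hle : ‖(mfderiv 𝓘(ℝ, ℝ) I (g ∘ γ) t (1 : ℝ) : TangentSpace I (g (γ t)))‖ ≤ C * φ t := by
      have h1 : mfderiv 𝓘(ℝ, ℝ) I (g ∘ γ) t (1 : ℝ) =
          mfderiv I I g (γ t) (mfderiv 𝓘(ℝ, ℝ) I γ t (1 : ℝ)) :=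
        congr($(mfderiv_comp t (hg (γ t)) (hγd t)) (1 : ℝ))
      rw [h1]
      exact ContinuousLinearMap.le_of_opNorm_le _ (by
        have h := hgC (γ t)
        simp only [enorm, ENNReal.coe_le_coe] at h
        exact_mod_cast h) _
    filter_upwards [nhdsWithin_le_nhds
      (eventually_riemannianEDist_curve_le I hd (hle.trans_lt hκ)), self_mem_nhdsWithin]
      with u hu htu
    rw [IsRiemannianManifold.out (I := I)]
    rwa [abs_of_pos (sub_pos.2 htu)] at hu

end Speed

/-! ### Coding orbits by finitely many symbols. -/

open Classical in
/-- The number of times `i < n` at which the orbit of `x` is outside `U`. -/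
noncomputable def badCount {M : Type*} (g : M → M) (U : Set M) (n : ℕ) (x : M) : ℕ :=
  Nat.count (fun i ↦ g^[i] x ∉ U) n

theorem badCount_iterate_le {M : Type*} (g : M → M) (U : Set M) (n q : ℕ) (x : M) :
    badCount g U (n - q) (g^[q] x) ≤ badCount g U n x := by
  classical
  rcases le_total n q with h | h
  · simp [badCount, Nat.sub_eq_zero_of_le h]
  · have h1 : badCount g U n x = badCount g U (q + (n - q)) x := by rw [Nat.add_sub_cancel' h]
    rw [h1]
    simp only [badCount]
    rw [Nat.count_add]
    simp only [← Function.iterate_add_apply, add_comm _ q]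
    exact Nat.le_add_left _ _

theorem badCount_succ_of_notMem {M : Type*} {g : M → M} {U : Set M} {x : M} (hx : x ∉ U) (n : ℕ) :
    badCount g U (n + 1) x = badCount g U n (g x) + 1 := by
  classical
  simp only [badCount]
  rw [Nat.count_succ']
  simp only [Function.iterate_zero, id_eq, hx, not_false_eq_true, if_true, Function.iterate_succ,
    Function.comp_apply]
  congr!

section OrbitCodes

variable {M : Type*} [EMetricSpace M] {g : M → M} {n q : ℕ} {ρ : ℝ≥0∞}

/-- The orbits of `x` and `y` stay at distance `< ρ` during `n` steps. -/
def OrbitClose (g : M → M) (n : ℕ) (ρ : ℝ≥0∞) (x y : M) : Prop :=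
  ∀ i < n, edist (g^[i] x) (g^[i] y) < ρ

/-- The points of `S` can be coded with at most `N` symbols in such a way that points with the same
code have `ρ`-close orbits during `n` steps. -/
def OrbitCodable (g : M → M) (S : Set M) (n : ℕ) (ρ : ℝ≥0∞) (N : ℕ) : Prop :=
  ∃ (ι : Type) (_ : Fintype ι) (c : M → ι), Fintype.card ι ≤ N ∧
    ∀ x ∈ S, ∀ y ∈ S, c x = c y → OrbitClose g n ρ x y

theorem OrbitClose.concat {x y : M} (h : OrbitClose g q ρ x y)
    (h' : OrbitClose g (n - q) ρ (g^[q] x) (g^[q] y)) : OrbitClose g n ρ x y := by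
  intro i hi
  rcases lt_or_ge i q with hiq | hiq
  · exact h i hiq
  · have := h' (i - q) (by omega)
    rwa [← Function.iterate_add_apply, ← Function.iterate_add_apply, Nat.sub_add_cancel hiq] at this

theorem OrbitCodable.mono {S : Set M} {N N' : ℕ} (h : OrbitCodable g S n ρ N) (hN : N ≤ N') :
    OrbitCodable g S n ρ N' := by
  obtain ⟨ι, hι, c, hcard, hc⟩ := h
  exact ⟨ι, hι, c, hcard.trans hN, hc⟩

theorem orbitCodable_zero (g : M → M) (S : Set M) (ρ : ℝ≥0∞) : OrbitCodable g S 0 ρ 1 :=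
  ⟨Unit, inferInstance, fun _ ↦ (), by simp, fun _ _ _ _ _ i hi ↦ absurd hi (Nat.not_lt_zero i)⟩

/-- The symbol of x is paired with that of g^q x. Truncated subtraction allows q > n, so a last
block may overrun the time n. -/
theorem OrbitCodable.concat {S S' : Set M} {N N' : ℕ} (h : OrbitCodable g S q ρ N)
    (h' : OrbitCodable g S' (n - q) ρ N') :
    OrbitCodable g (S ∩ g^[q] ⁻¹' S') n ρ (N * N') := by
  obtain ⟨ι, hι, c, hcard, hc⟩ := h
  obtain ⟨ι', hι', c', hcard', hc'⟩ := h'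
  refine ⟨ι × ι', inferInstance, fun x ↦ (c x, c' (g^[q] x)), ?_, ?_⟩
  · rw [Fintype.card_prod]
    exact Nat.mul_le_mul hcard hcard'
  · intro x hx y hy hxy
    rw [Prod.mk.injEq] at hxy
    exact (hc x hx.1 y hy.1 hxy.1).concat (hc' _ hx.2 _ hy.2 hxy.2)

theorem OrbitCodable.mono_set {S S' : Set M} {N : ℕ} (h : OrbitCodable g S n ρ N) (hS : S' ⊆ S) :
    OrbitCodable g S' n ρ N := by
  obtain ⟨ι, hι, c, hcard, hc⟩ := h
  exact ⟨ι, hι, c, hcard, fun x hx y hy ↦ hc x (hS hx) y (hS hy)⟩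

theorem OrbitCodable.union {S S' : Set M} {N N' : ℕ}
    (h : OrbitCodable g S n ρ N) (h' : OrbitCodable g S' n ρ N') :
    OrbitCodable g (S ∪ S') n ρ (N + N') := by
  classical
  obtain ⟨ι, hι, c, hcard, hc⟩ := h
  obtain ⟨ι', hι', c', hcard', hc'⟩ := h'
  refine ⟨ι ⊕ ι', inferInstance, fun x ↦ if x ∈ S then .inl (c x) else .inr (c' x), ?_, ?_⟩
  · rw [Fintype.card_sum]
    exact Nat.add_le_add hcard hcard'
  · intro x hx y hy hxy
    by_cases hxS : x ∈ S <;> by_cases hyS : y ∈ S <;> simp only [hxS, hyS, if_true, if_false,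
      reduceCtorEq, Sum.inl.injEq, Sum.inr.injEq] at hxy
    · exact hc x hxS y hyS hxy
    · exact hc' x (hx.resolve_left hxS) y (hy.resolve_left hyS) hxy

theorem OrbitCodable.pow {R : ℕ} (h : OrbitCodable g univ q ρ R) (k : ℕ) :
    OrbitCodable g univ (k * q) ρ (R ^ k) := by
  induction k with
  | zero => simpa using orbitCodable_zero g univ ρ
  | succ k ih =>
    have hsub : (k + 1) * q - q = k * q := by rw [Nat.add_mul, one_mul, Nat.add_sub_cancel]
    have := OrbitCodable.concat (n := (k + 1) * q) h (hsub ▸ ih)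
    simpa [pow_succ'] using this

/-- If orbits can be coded cheaply over `q` steps from each point of `U`, then so can the orbits
which are seldom outside `U`. -/
theorem orbitCodable_badCount_le {U : Set M} {N K : ℕ} (hq : 0 < q) (hN : 1 ≤ N) (hK : 1 ≤ K)
    (hU : OrbitCodable g U q ρ N) (h1 : OrbitCodable g univ 1 ρ K) (n : ℕ) :
    ∀ m b : ℕ, n ≤ m * q →
      OrbitCodable g {x | badCount g U n x ≤ b} n ρ ((2 * N) ^ m * (2 * K) ^ b) := by
  induction n using Nat.strong_induction_on with
  | _ n ih =>
    intro m b hm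
    rcases Nat.eq_zero_or_pos n with rfl | hn
    · exact (orbitCodable_zero g _ ρ).mono (Nat.one_le_iff_ne_zero.2 (by positivity))
    obtain ⟨m, rfl⟩ : ∃ m', m = m' + 1 :=
      Nat.exists_eq_succ_of_ne_zero (by rintro rfl; omega)
    -- A start in U consumes a block of q steps and lowers m; a start outside consumes one step and
    -- lowers b. Each case gets half of the bound, which is why N and K are doubled.
    have hA := hU.concat (ih (n - q) (by omega) m b (by rw [Nat.add_mul] at hm; omega))
    have hB : OrbitCodable g ({x | badCount g U n x ≤ b} \ U) n ρ
        ((2 * N) ^ m * N * (2 * K) ^ b) := by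
      rcases b with _ | b
      -- For b = 0 the set is empty, since a start outside U is already a bad time.
      · refine ⟨Unit, inferInstance, fun _ ↦ (), ?_, ?_⟩
        · simpa using Nat.one_le_iff_ne_zero.2 (by positivity)
        · rintro x ⟨hx, hxU⟩
          obtain ⟨n, rfl⟩ := Nat.exists_eq_succ_of_ne_zero hn.ne'
          simp [badCount_succ_of_notMem hxU] at hx
      · have hB := h1.concat (ih (n - 1) (by omega) (m + 1) b (by omega))
        refine (hB.mono_set ?_).mono ?_
        · rintro x ⟨hx, hxU⟩
          obtain ⟨n, rfl⟩ := Nat.exists_eq_succ_of_ne_zero hn.ne'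
          simpa [badCount_succ_of_notMem hxU] using hx
        · apply le_of_eq
          ring
    refine ((hA.union hB).mono_set ?_).mono ?_
    · intro x hx
      by_cases hxU : x ∈ U
      · exact Or.inl ⟨hxU, (badCount_iterate_le g U n q x).trans hx⟩
      · exact Or.inr ⟨hx, hxU⟩
    · apply le_of_eq
      ring

/-- Dynamical balls provide codes. -/
theorem orbitCodable_biUnion_dynBall (g : M → M) (n : ℕ) {δ : ℝ} (hδ : 0 ≤ δ)
    {t : Finset M} (ht : t.Nonempty) :
    OrbitCodable g (⋃ y ∈ t, dynBall g n y δ) n (ENNReal.ofReal (2 * δ)) t.card := by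
  classical
  have hsel : ∀ x : M, ∃ y : t, x ∈ ⋃ y ∈ t, dynBall g n y δ → x ∈ dynBall g n y δ := by
    intro x
    by_cases hx : x ∈ ⋃ y ∈ t, dynBall g n y δ
    · obtain ⟨y, hy, hxy⟩ := mem_iUnion₂.1 hx
      exact ⟨⟨y, hy⟩, fun _ ↦ hxy⟩
    · exact ⟨⟨ht.choose, ht.choose_spec⟩, fun h ↦ absurd h hx⟩
  choose c hc using hsel
  refine ⟨Fin t.card, inferInstance, fun x ↦ t.equivFin (c x), by simp, ?_⟩
  intro x hx y hy hxy i hi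
  have hxy' : c x = c y := t.equivFin.injective hxy
  have h1 := hc x hx i hi
  have h2 := hc y hy i hi
  rw [← hxy', edist_comm] at h2
  rw [two_mul, ENNReal.ofReal_add hδ hδ]
  exact (edist_triangle _ _ _).trans_lt (ENNReal.add_lt_add h1 h2)

/-- A code is injective on net points in S: if x and y shared a symbol, y would lie in both of their
dynamical V-balls, which are disjoint in a net. -/
theorem card_le_of_orbitCodable {V : SetRel M M} (hV : ∀ x y, edist x y < ρ → (x, y) ∈ V)
    (hρ : 0 < ρ) {E : Finset M} (hE : Dynamics.IsDynNetIn g univ V n E) {S : Set M} {N : ℕ}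
    (hS : OrbitCodable g S n ρ N) {A : Finset M} (hAE : A ⊆ E) (hAS : ∀ x ∈ A, x ∈ S) :
    A.card ≤ N := by
  obtain ⟨ι, hι, c, hcard, hc⟩ := hS
  refine (Finset.card_le_card_of_injOn (t := Finset.univ) c (by simp) ?_).trans hcard
  intro x hx y hy hxy
  by_contra hne
  refine Set.disjoint_left.1 (hE.2 (hAE hx) (hAE hy) hne) (?_ : y ∈ _) ?_
  · rw [Dynamics.mem_ball_dynEntourage]
    exact fun i hi ↦ hV _ _ (hc x (hAS x hx) y (hAS y hy) hxy i hi)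
  · rw [Dynamics.mem_ball_dynEntourage]
    exact fun i hi ↦ hV _ _ (by simpa using hρ)

end OrbitCodes

/-! ### Empirical measures and their invariant limits. -/

section Empirical

open scoped BoundedContinuousFunction

/-- The uniform measure on the orbit segments of length `n` of the points of `E`. -/
noncomputable def empiricalMeasure {M : Type*} [MeasurableSpace M] (g : M → M) (E : Finset M)
    (n : ℕ) : Measure M :=
  ((n * E.card : ℕ) : ℝ≥0∞)⁻¹ • ∑ x ∈ E, ∑ i ∈ Finset.range n, Measure.dirac (g^[i] x)

theorem isProbabilityMeasure_empiricalMeasure {M : Type*} [MeasurableSpace M] (g : M → M)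
    {E : Finset M} {n : ℕ} (hE : E.Nonempty) (hn : n ≠ 0) :
    IsProbabilityMeasure (empiricalMeasure g E n) := by
  constructor
  have h : ((n * E.card : ℕ) : ℝ≥0∞) ≠ 0 := by
    exact_mod_cast mul_ne_zero hn hE.card_pos.ne'
  simp only [empiricalMeasure, Measure.smul_apply, Measure.finsetSum_apply, measure_univ,
    Finset.sum_const, Finset.card_range, smul_eq_mul, nsmul_eq_mul, mul_one]
  rw [mul_comm (E.card : ℝ≥0∞), ← Nat.cast_mul]
  exact ENNReal.inv_mul_cancel h (ENNReal.natCast_ne_top _)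

theorem integral_empiricalMeasure {M : Type*} [MeasurableSpace M] [TopologicalSpace M]
    [OpensMeasurableSpace M] (g : M → M) (E : Finset M) (n : ℕ) (φ : M →ᵇ ℝ) :
    ∫ x, φ x ∂(empiricalMeasure g E n) =
      ((n * E.card : ℕ) : ℝ)⁻¹ * ∑ x ∈ E, ∑ i ∈ Finset.range n, φ (g^[i] x) := by
  have hφ : ∀ x ∈ E, ∀ i ∈ Finset.range n, Integrable φ (Measure.dirac (g^[i] x)) :=
    fun x _ i _ ↦ φ.integrable _
  rw [empiricalMeasure, integral_smul_measure, integral_finsetSum_measure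
    (fun x hx ↦ integrable_finsetSum_measure.2 (hφ x hx))]
  simp only [ENNReal.toReal_inv, ENNReal.toReal_natCast, smul_eq_mul]
  congr 1
  refine Finset.sum_congr rfl fun x hx ↦ ?_
  rw [integral_finsetSum_measure (hφ x hx)]
  exact Finset.sum_congr rfl fun i _ ↦
    integral_dirac' _ _ φ.continuous.measurable.stronglyMeasurable

/-- Empirical measures of long orbit segments are almost invariant. -/
theorem abs_integral_comp_sub_integral_empiricalMeasure_le {M : Type*} [MeasurableSpace M]
    [TopologicalSpace M] [OpensMeasurableSpace M] (g : C(M, M)) {E : Finset M} {n : ℕ}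
    (hE : E.Nonempty) (φ : M →ᵇ ℝ) :
    |∫ x, φ (g x) ∂(empiricalMeasure g E n) - ∫ x, φ x ∂(empiricalMeasure g E n)| ≤
      2 * ‖φ‖ / n := by
  have h1 := integral_empiricalMeasure g E n (φ.compContinuous g)
  simp only [BoundedContinuousFunction.compContinuous_apply] at h1
  rw [h1, integral_empiricalMeasure, ← mul_sub, ← Finset.sum_sub_distrib]
  have h2 : ∀ x ∈ E, |∑ i ∈ Finset.range n, φ (g (g^[i] x)) -
      ∑ i ∈ Finset.range n, φ (g^[i] x)| ≤ 2 * ‖φ‖ := by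
    intro x _
    rw [← Finset.sum_sub_distrib]
    simp only [← Function.iterate_succ_apply' (g : M → M)]
    rw [Finset.sum_range_sub (fun i ↦ φ ((g : M → M)^[i] x))]
    have := φ.norm_coe_le_norm (g^[n] x)
    have := φ.norm_coe_le_norm (g^[0] x)
    rw [Real.norm_eq_abs] at *
    exact (abs_sub _ _).trans (by linarith)
  rcases Nat.eq_zero_or_pos n with rfl | hn
  · simp
  have hn' : (0 : ℝ) < n := by exact_mod_cast hn
  have hc : (0 : ℝ) < E.card := by exact_mod_cast hE.card_pos
  rw [abs_mul, abs_of_pos (by positivity), Nat.cast_mul]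
  calc ((n : ℝ) * E.card)⁻¹ * |_| ≤ ((n : ℝ) * E.card)⁻¹ * (E.card * (2 * ‖φ‖)) := by
        gcongr
        refine (Finset.abs_sum_le_sum_abs _ _).trans ((Finset.sum_le_sum h2).trans ?_)
        simp
    _ = 2 * ‖φ‖ / n := by field_simp

/-- Krylov–Bogolyubov: along any infinite set of times, empirical measures accumulate at an
invariant probability measure; by the portmanteau theorem the accumulation bounds the measures of
open sets from below. -/
theorem exists_invariant_frequently_lt_empiricalMeasure {M : Type*} [EMetricSpace M]
    [CompactSpace M] [MeasurableSpace M] [BorelSpace M] (g : C(M, M)) {E : ℕ → Finset M}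
    (hE : ∃ᶠ n in atTop, (E n).Nonempty) :
    ∃ μ : Measure M, IsProbabilityMeasure μ ∧ MeasurePreserving g μ μ ∧
      ∀ U : Set M, IsOpen U → ∀ a < μ U,
        ∃ᶠ n in atTop, (E n).Nonempty ∧ a < empiricalMeasure g (E n) n U := by
  classical
  have hE' : ∃ᶠ n in atTop, n ≠ 0 ∧ (E n).Nonempty :=
    (hE.and_eventually (eventually_ne_atTop 0)).mono fun _ h ↦ h.symm
  obtain ⟨x₀, -⟩ := hE.exists.choose_spec
  -- The Dirac mass is a dummy value at the excluded times, which the ultrafilter below does not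
  -- see.
  let ν : ℕ → ProbabilityMeasure M := fun n ↦
    if h : n ≠ 0 ∧ (E n).Nonempty then
      ⟨empiricalMeasure g (E n) n, isProbabilityMeasure_empiricalMeasure g h.2 h.1⟩
    else ⟨Measure.dirac x₀, inferInstance⟩
  have hν : ∀ n, n ≠ 0 ∧ (E n).Nonempty → (ν n : Measure M) = empiricalMeasure g (E n) n := by
    intro n h
    have h' : ν n = ⟨_, isProbabilityMeasure_empiricalMeasure g h.2 h.1⟩ := dif_pos h
    rw [h']
    rfl
  let l : Filter ℕ := atTop ⊓ 𝓟 {n | n ≠ 0 ∧ (E n).Nonempty}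
  have hl : l.NeBot := frequently_mem_iff_neBot.1 hE'
  let 𝓕 : Ultrafilter ℕ := Ultrafilter.of l
  have h𝓕 : (𝓕 : Filter ℕ) ≤ l := Ultrafilter.of_le l
  have h𝓕top : (𝓕 : Filter ℕ) ≤ atTop := h𝓕.trans inf_le_left
  have h𝓕E : ∀ᶠ n in (𝓕 : Filter ℕ), n ≠ 0 ∧ (E n).Nonempty :=
    h𝓕 (mem_inf_of_right (mem_principal_self _))
  obtain ⟨μ, -, hμ⟩ := isCompact_univ.ultrafilter_le_nhds (𝓕.map ν) (by simp)
  have hlim : Tendsto ν 𝓕 (𝓝 μ) := hμ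
  have hint := ProbabilityMeasure.tendsto_iff_forall_integral_tendsto.1 hlim
  refine ⟨μ, inferInstance, ⟨g.continuous.measurable, ?_⟩, ?_⟩
  · have : IsProbabilityMeasure ((μ : Measure M).map g) :=
      Measure.isProbabilityMeasure_map g.continuous.aemeasurable
    refine ext_of_forall_integral_eq_of_IsFiniteMeasure fun φ ↦ ?_
    rw [integral_map g.continuous.aemeasurable φ.continuous.aestronglyMeasurable]
    have h1 := hint (φ.compContinuous g)
    simp only [BoundedContinuousFunction.compContinuous_apply] at h1
    have h2 := h1.sub (hint φ)
    refine sub_eq_zero.1 (tendsto_nhds_unique h2 ?_)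
    have h3 : Tendsto (fun n : ℕ ↦ 2 * ‖φ‖ / n) 𝓕 (𝓝 0) :=
      (tendsto_const_div_atTop_nhds_zero_nat _).mono_left h𝓕top
    refine squeeze_zero_norm' ?_ h3
    filter_upwards [h𝓕E] with n hn
    rw [hν n hn, Real.norm_eq_abs]
    exact abs_integral_comp_sub_integral_empiricalMeasure_le g hn.2 φ
  · intro U hU a ha
    have h1 := lt_of_lt_of_le ha (ProbabilityMeasure.le_liminf_measure_open_of_tendsto hlim hU)
    have h2 : ∀ᶠ n in (𝓕 : Filter ℕ), a < (ν n : Measure M) U := eventually_lt_of_lt_liminf h1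
    have h3 : ∃ᶠ n in (𝓕 : Filter ℕ), (E n).Nonempty ∧ a < empiricalMeasure g (E n) n U := by
      refine Eventually.frequently ?_
      filter_upwards [h2, h𝓕E] with n hn hnE
      exact ⟨hnE.2, hν n hnE ▸ hn⟩
    exact h3.filter_mono h𝓕top

/-- The measure of `U` counts the times that are not bad. -/
theorem empiricalMeasure_apply_eq {M : Type*} [MeasurableSpace M] (g : M → M) (E : Finset M)
    (n : ℕ) {U : Set M} (hU : MeasurableSet U) :
    empiricalMeasure g E n U =
      ((n * E.card : ℕ) : ℝ≥0∞)⁻¹ * ((∑ x ∈ E, (n - badCount g U n x) : ℕ) : ℝ≥0∞) := by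
  classical
  have h : ∀ x : M, (∑ i ∈ Finset.range n, Measure.dirac (g^[i] x) U : ℝ≥0∞) =
      ((n - badCount g U n x : ℕ) : ℝ≥0∞) := by
    intro x
    have h1 : n - badCount g U n x = ((Finset.range n).filter fun i ↦ g^[i] x ∈ U).card := by
      have h2 := Finset.card_filter_add_card_filter_not (s := Finset.range n)
        (fun i ↦ g^[i] x ∈ U)
      rw [Finset.card_range] at h2
      rw [badCount, Nat.count_eq_card_filter_range]
      rw [Nat.sub_eq_of_eq_add]
      convert h2.symm
    rw [h1, Finset.card_filter, Nat.cast_sum]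
    refine Finset.sum_congr rfl fun i _ ↦ ?_
    rw [Measure.dirac_apply' _ hU, indicator_apply]
    split_ifs <;> simp
  simp only [empiricalMeasure, Measure.smul_apply, Measure.finsetSum_apply, smul_eq_mul, h,
    Nat.cast_sum]

theorem badCount_le {M : Type*} (g : M → M) (U : Set M) (n : ℕ) (x : M) : badCount g U n x ≤ n :=
  open Classical in Nat.count_le _

/-- Markov's inequality for the number of times spent outside `U`. -/
theorem exists_card_le_two_mul_badCount_le {M : Type*} [MeasurableSpace M] {g : M → M}
    {E : Finset M} {n : ℕ} {U : Set M} (hU : MeasurableSet U) {s : ℝ} (hs0 : 0 < s)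
    (hμ : ENNReal.ofReal (1 - 2 * s) < empiricalMeasure g E n U)
    {b : ℕ} (hb : 4 * s * n ≤ b + 1) :
    ∃ A ⊆ E, (∀ x ∈ A, badCount g U n x ≤ b) ∧ E.card ≤ 2 * A.card := by
  classical
  refine ⟨E.filter fun x ↦ badCount g U n x ≤ b, Finset.filter_subset _ _, by simp, ?_⟩
  have hsplit := Finset.card_filter_add_card_filter_not (s := E) (fun x ↦ badCount g U n x ≤ b)
  set A := E.filter fun x ↦ badCount g U n x ≤ b
  set A' := E.filter fun x ↦ ¬ badCount g U n x ≤ b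
  rw [empiricalMeasure_apply_eq g E n hU] at hμ
  rcases Nat.eq_zero_or_pos (n * E.card) with h0 | hpos
  · rcases Nat.mul_eq_zero.1 h0 with rfl | h0
    · simp at hμ
    · rw [h0]
      exact Nat.zero_le _
  have hlt : (1 - 2 * s) * ((n : ℝ) * E.card) < ((∑ x ∈ E, (n - badCount g U n x) : ℕ) : ℝ) := by
    rw [mul_comm _⁻¹, ← div_eq_mul_inv, ← ENNReal.ofReal_natCast, ← ENNReal.ofReal_natCast (n * _),
      ← ENNReal.ofReal_div_of_pos (by exact_mod_cast hpos)] at hμ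
    have h := ENNReal.ofReal_lt_ofReal_iff'.1 hμ
    rw [lt_div_iff₀ (by exact_mod_cast hpos)] at h
    exact_mod_cast h.1
  have hsum : ((∑ x ∈ E, (n - badCount g U n x) : ℕ) : ℝ) =
      n * E.card - ∑ x ∈ E, (badCount g U n x : ℝ) := by
    push_cast [Nat.cast_sub (badCount_le g U n _)]
    rw [Finset.sum_sub_distrib]
    simp [mul_comm]
  -- Exceeding b means at least b + 1 ≥ 4sn bad times. As the mean number is below 2sn, fewer than
  -- half of the points do so.
  have hbad : (A'.card : ℝ) * (4 * s * n) ≤ ∑ x ∈ E, (badCount g U n x : ℝ) := by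
    calc (A'.card : ℝ) * (4 * s * n) = ∑ x ∈ A', (4 * s * n) := by simp
      _ ≤ ∑ x ∈ A', (badCount g U n x : ℝ) := by
          refine Finset.sum_le_sum fun x hx ↦ hb.trans ?_
          have := (Finset.mem_filter.1 hx).2
          exact_mod_cast (by omega : b + 1 ≤ badCount g U n x)
      _ ≤ _ := Finset.sum_le_sum_of_subset_of_nonneg (Finset.filter_subset _ _)
          fun _ _ _ ↦ Nat.cast_nonneg _
  have hn : (0 : ℝ) < n := by exact_mod_cast Nat.pos_of_mul_pos_right hpos
  have hsn : 0 < 2 * s * n := by positivity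
  have hfin : (2 * A'.card : ℝ) < E.card := by
    refine lt_of_mul_lt_mul_left ?_ hsn.le
    nlinarith
  have : 2 * A'.card < E.card := by exact_mod_cast hfin
  omega

end Empirical

/-! ### Cheap codes near F, and large nets. -/

section Core

variable {M : Type*} [EMetricSpace M]

theorem near_mem_uniformity {ε : ℝ} (hε : 0 < ε) : near M ε ∈ uniformity M :=
  mem_uniformity_edist.2 ⟨ENNReal.ofReal ε, ENNReal.ofReal_pos.2 hε, fun h ↦ h⟩

theorem isOpen_dynBall {g : M → M} (hg : Continuous g) (n : ℕ) (x : M) (ε : ℝ) :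
    IsOpen (dynBall g n x ε) := by
  have : dynBall g n x ε = ⋂ i ∈ Finset.range n,
      {y | edist (g^[i] y) (g^[i] x) < ENNReal.ofReal ε} := by
    ext y
    simp [dynBall]
  rw [this]
  exact isOpen_biInter_finset fun i _ ↦
    isOpen_lt ((hg.iterate i).edist continuous_const) continuous_const

/-- Dynamical covers are covers by dynamical balls. -/
theorem isDynCoverOf_near_iff {g : M → M} {F : Set M} {ε : ℝ} {n : ℕ} {t : Set M} :
    Dynamics.IsDynCoverOf g F (near M ε) n t ↔ F ⊆ ⋃ y ∈ t, dynBall g n y ε := by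
  constructor
  · intro h x hx
    obtain ⟨y, hy, hxy⟩ := h hx
    rw [Dynamics.mem_dynEntourage] at hxy
    exact mem_iUnion₂.2 ⟨y, hy, hxy⟩
  · intro h x hx
    obtain ⟨y, hy, hxy⟩ := mem_iUnion₂.1 (h hx)
    exact ⟨y, hy, Dynamics.mem_dynEntourage.2 hxy⟩

theorem exists_dynBall_cover_of_spanCard_le {g : M → M} {F : Set M} {ε : ℝ} {n : ℕ} {a : ℝ}
    (h : spanCard g F ε n ≤ ENNReal.ofReal a) (ha : 0 ≤ a) :
    ∃ t : Finset M, F ⊆ ⋃ y ∈ t, dynBall g n y ε ∧ (t.card : ℝ) ≤ a := by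
  have hfin : Dynamics.coverMincard g F (near M ε) n < ⊤ := by
    rw [spanCard] at h
    exact ENat.toENNReal_lt_top.1 (h.trans_lt ENNReal.ofReal_lt_top)
  obtain ⟨t, ht, hcard⟩ := (Dynamics.coverMincard_finite_iff _ _ _ _).1 hfin
  refine ⟨t, by simpa using isDynCoverOf_near_iff.1 ht, ?_⟩
  rw [spanCard, ← hcard] at h
  rw [← ENNReal.ofReal_le_ofReal_iff ha]
  simpa using h

/-- Local entropy on `F` at scale `η` turns a code of all orbits at scale `η` into a code of the
orbits which start near `F`, at an arbitrarily small scale. -/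
theorem eventually_orbitCodable_of_localEntropyOn_lt {g : M → M} (hg : Continuous g) {F : Set M}
    (hF : F.Nonempty) {η l : ℝ} (hl : localEntropyOn g F η < l) {p R : ℕ} (hp : 0 < p)
    (hR : OrbitCodable g univ p (ENNReal.ofReal η) R) {δ : ℝ} (hδ : 0 < δ) :
    ∀ᶠ k : ℕ in atTop, ∃ (U : Set M) (N : ℕ), IsOpen U ∧ F ⊆ U ∧ 1 ≤ N ∧
      (N : ℝ) ≤ R ^ k * Real.exp (l * (k * p)) ∧
      OrbitCodable g U (k * p) (ENNReal.ofReal (2 * δ)) N := by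
  classical
  have h1 : ExpGrowth.expGrowthSup
      (fun n : ℕ ↦ ⨆ x ∈ F, spanCard g (F ∩ dynBall g n x η) δ n) < l :=
    lt_of_le_of_lt (le_iSup₂ (f := fun (δ : ℝ) (_ : 0 < δ) ↦ ExpGrowth.expGrowthSup
      (fun n : ℕ ↦ ⨆ x ∈ F, spanCard g (F ∩ dynBall g n x η) δ n)) δ hδ) hl
  have h2 := ExpGrowth.eventually_le_exp h1
  have htop : Tendsto (fun k : ℕ ↦ k * p) atTop atTop :=
    tendsto_id.atTop_mul_const' hp
  filter_upwards [htop.eventually h2] with k hk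
  have hexp : EReal.exp ((l : EReal) * ((k * p : ℕ) : EReal)) =
      ENNReal.ofReal (Real.exp (l * (k * p))) := by
    rw [← EReal.exp_coe]
    push_cast
    rfl
  rw [hexp] at hk
  obtain ⟨ι, hι, c, hcard, hc⟩ := hR.pow k
  -- A cell that meets F has its trace on F inside an η-dynamical ball centred in F, to which the
  -- local entropy bound applies.
  have hcell : ∀ j : ι, ∃ t : Finset M, F ∩ c ⁻¹' {j} ⊆ ⋃ y ∈ t, dynBall g (k * p) y δ ∧
      (t.card : ℝ) ≤ Real.exp (l * (k * p)) := by
    intro j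
    rcases (F ∩ c ⁻¹' {j}).eq_empty_or_nonempty with hj | ⟨x, hxF, hxj⟩
    · exact ⟨∅, by simp [hj], by simpa using (Real.exp_pos _).le⟩
    · have hx : spanCard g (F ∩ dynBall g (k * p) x η) δ (k * p) ≤
          ENNReal.ofReal (Real.exp (l * (k * p))) :=
        (le_iSup₂ (f := fun x (_ : x ∈ F) ↦ spanCard g (F ∩ dynBall g (k * p) x η) δ (k * p))
          x hxF).trans hk
      obtain ⟨t, ht, htc⟩ := exists_dynBall_cover_of_spanCard_le hx (Real.exp_pos _).le
      refine ⟨t, subset_trans ?_ ht, htc⟩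
      rintro y ⟨hyF, hyj⟩
      exact ⟨hyF, hc y (mem_univ _) x (mem_univ _) (hyj.trans hxj.symm)⟩
  choose t ht htc using hcell
  let T : Finset M := Finset.univ.biUnion t
  have hFT : F ⊆ ⋃ y ∈ T, dynBall g (k * p) y δ := by
    intro x hx
    obtain ⟨y, hy, hxy⟩ := mem_iUnion₂.1 (ht (c x) ⟨hx, rfl⟩)
    exact mem_iUnion₂.2 ⟨y, Finset.mem_biUnion.2 ⟨c x, Finset.mem_univ _, hy⟩, hxy⟩
  have hT : T.Nonempty := by
    obtain ⟨x, hx⟩ := hF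
    obtain ⟨y, hy, -⟩ := mem_iUnion₂.1 (hFT hx)
    exact ⟨y, hy⟩
  refine ⟨_, T.card, isOpen_biUnion fun y _ ↦ isOpen_dynBall hg _ y δ, hFT, hT.card_pos, ?_,
    orbitCodable_biUnion_dynBall g (k * p) hδ.le hT⟩
  calc (T.card : ℝ) ≤ ∑ j, ((t j).card : ℝ) := by exact_mod_cast Finset.card_biUnion_le
    _ ≤ ∑ _j : ι, Real.exp (l * (k * p)) := Finset.sum_le_sum fun j _ ↦ htc j
    _ = Fintype.card ι * Real.exp (l * (k * p)) := by simp
    _ ≤ R ^ k * Real.exp (l * (k * p)) := by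
        gcongr
        exact_mod_cast hcard

theorem exists_orbitCodable_one [CompactSpace M] [Nonempty M] (g : M → M) {δ : ℝ} (hδ : 0 < δ) :
    ∃ K : ℕ, 1 ≤ K ∧ OrbitCodable g univ 1 (ENNReal.ofReal (2 * δ)) K := by
  obtain ⟨t, ht⟩ := Dynamics.exists_isDynCoverOf_of_isCompact_invariant (T := g) isCompact_univ
    (mapsTo_univ g univ) (near_mem_uniformity (M := M) hδ) 1
  have hne : t.Nonempty := by
    simpa using ht.nonempty univ_nonempty
  refine ⟨t.card, hne.card_pos, (orbitCodable_biUnion_dynBall g 1 hδ.le hne).mono_set ?_⟩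
  simpa using isDynCoverOf_near_iff.1 ht

/-- Large nets at a fixed scale, along infinitely many times. -/
theorem frequently_exists_net_of_lt_topEntropy [CompactSpace M] {g : M → M} {a : ℝ}
    (ha : (a : EReal) < topEntropy g) :
    ∃ δ > 0, ∃ V : SetRel M M, (∀ x y, edist x y < ENNReal.ofReal (2 * δ) → (x, y) ∈ V) ∧
      ∃ᶠ n : ℕ in atTop, ∃ E : Finset M, Dynamics.IsDynNetIn g univ V n E ∧
        Real.exp (a * n) ≤ E.card := by
  rw [topEntropy, Dynamics.coverEntropy_eq_iSup_netEntropyEntourage] at ha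
  simp only [lt_iSup_iff] at ha
  obtain ⟨V, hV, ha⟩ := ha
  obtain ⟨ε, hε, hεV⟩ := mem_uniformity_edist.1 hV
  -- The factor 2 anticipates that δ-balls give codes at scale 2δ.
  obtain ⟨δ, hδ, hδε⟩ : ∃ δ : ℝ, 0 < δ ∧ ENNReal.ofReal (2 * δ) ≤ ε := by
    rcases eq_or_ne ε ⊤ with rfl | hε'
    · exact ⟨1, one_pos, le_top⟩
    · refine ⟨ε.toReal / 2, half_pos (ENNReal.toReal_pos hε.ne' hε'), ?_⟩
      rw [mul_div_cancel₀ _ two_ne_zero, ENNReal.ofReal_toReal hε']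
  refine ⟨δ, hδ, V, fun x y hxy ↦ hεV (hxy.trans_le hδε), ?_⟩
  refine (ExpGrowth.frequently_exp_le ha).mono fun n hn ↦ ?_
  have hfin : Dynamics.netMaxcard g univ V n < ⊤ :=
    (Dynamics.netMaxcard_le_coverMincard g univ n).trans_lt
      (Dynamics.coverMincard_finite_of_isCompact_invariant isCompact_univ (mapsTo_univ g univ) hV n)
  obtain ⟨E, hE, hcard⟩ := (Dynamics.netMaxcard_finite_iff _ _ _ _).1 hfin
  refine ⟨E, hE, ?_⟩
  have hexp : EReal.exp ((a : EReal) * (n : EReal)) = ENNReal.ofReal (Real.exp (a * n)) := by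
    rw [← EReal.exp_coe]
    push_cast
    rfl
  rw [hexp, ← hcard] at hn
  rw [← ENNReal.ofReal_le_ofReal_iff (Nat.cast_nonneg _)]
  simpa using hn

end Core

/-! ### The central estimate and the passage from f to g. -/

section Estimate

variable {M : Type*} [EMetricSpace M]

/-- The exponential rate left over from a bound on the cardinality of nets. -/
theorem le_of_frequently_exp_le {a s : ℝ} {q N K : ℕ} (hq : 0 < q) (hN : 1 ≤ N) (hK : 1 ≤ K)
    (h : ∃ᶠ n : ℕ in atTop, ∃ b : ℕ, (b : ℝ) ≤ s * n ∧
      Real.exp (a * n) ≤ 2 * ((2 * N) ^ (n / q + 1) * (2 * K) ^ b)) :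
    a ≤ Real.log (2 * N) / q + s * Real.log (2 * K) := by
  have hq' : (0 : ℝ) < q := by exact_mod_cast hq
  have hN' : (1 : ℝ) ≤ N := by exact_mod_cast hN
  have hK' : (1 : ℝ) ≤ K := by exact_mod_cast hK
  have hlN : 0 ≤ Real.log (2 * N) := Real.log_nonneg (by linarith)
  have hlK : 0 ≤ Real.log (2 * K) := Real.log_nonneg (by linarith)
  have hlim : Tendsto (fun n : ℕ ↦ Real.log (2 * N) / q + s * Real.log (2 * K) +
      (Real.log 2 + Real.log (2 * N)) / n) atTop
      (𝓝 (Real.log (2 * N) / q + s * Real.log (2 * K) + 0)) :=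
    tendsto_const_nhds.add (tendsto_const_div_atTop_nhds_zero_nat _)
  rw [add_zero] at hlim
  refine ge_of_tendsto_of_frequently hlim ?_
  refine (h.and_eventually (eventually_gt_atTop 0)).mono ?_
  rintro n ⟨⟨b, hb, hexp⟩, hn⟩
  have hn' : (0 : ℝ) < n := by exact_mod_cast hn
  have h1 := Real.log_le_log (Real.exp_pos _) hexp
  rw [Real.log_exp, Real.log_mul (by norm_num) (by positivity), Real.log_mul (by positivity)
    (by positivity), Real.log_pow, Real.log_pow] at h1
  have h2 : ((n / q + 1 : ℕ) : ℝ) * Real.log (2 * N) ≤ (n / q + 1) * Real.log (2 * N) := by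
    gcongr
    push_cast
    gcongr
    exact Nat.cast_div_le
  have h3 : (b : ℝ) * Real.log (2 * K) ≤ s * n * Real.log (2 * K) := by gcongr
  refine le_of_mul_le_mul_right ?_ hn'
  calc a * n ≤ Real.log 2 + ((n / q + 1) * Real.log (2 * N) + s * n * Real.log (2 * K)) := by
        linarith
    _ = _ := by field_simp; ring

/-- The parameters are fixed in the order a, δ, K, s, k. The single-step cost K depends on δ but not
on s, so the price 4s log(2K) of the bad times vanishes as s → 0. -/
theorem topEntropy_le_of_orbitCodable [CompactSpace M] [Nonempty M] [MeasurableSpace M]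
    [BorelSpace M] (g : C(M, M)) {η l : ℝ} {p R : ℕ} (hp : 0 < p)
    (hR : OrbitCodable g univ p (ENNReal.ofReal η) R) (hl : localEntropy g η < l) :
    topEntropy g ≤ ((Real.log R / p + l : ℝ) : EReal) := by
  classical
  refine EReal.ge_of_forall_gt_iff_ge.1 fun a ha ↦ EReal.coe_le_coe_iff.2 ?_
  obtain ⟨δ, hδ, V, hV, hfreq⟩ := frequently_exists_net_of_lt_topEntropy ha
  let E : ℕ → Finset M := fun n ↦ if h : ∃ E : Finset M, Dynamics.IsDynNetIn g univ V n E ∧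
    Real.exp (a * n) ≤ E.card then h.choose else ∅
  have hEne : ∀ n, (E n).Nonempty → Dynamics.IsDynNetIn g univ V n (E n) ∧
      Real.exp (a * n) ≤ (E n).card := by
    intro n hn
    by_cases h : ∃ E : Finset M, Dynamics.IsDynNetIn g univ V n E ∧ Real.exp (a * n) ≤ E.card
    · simp only [E, dif_pos h]
      exact h.choose_spec
    · simp [E, dif_neg h] at hn
  have hEfreq : ∃ᶠ n in atTop, (E n).Nonempty := by
    refine hfreq.mono fun n h ↦ ?_
    simp only [E, dif_pos h]
    have h1 := (Real.exp_pos _).trans_le h.choose_spec.2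
    exact Finset.card_pos.1 (by exact_mod_cast h1)
  obtain ⟨μ, hμ, hμg, hμE⟩ := exists_invariant_frequently_lt_empiricalMeasure g hEfreq
  have hμl : localEntropyMeasure g μ η < l := by
    refine lt_of_le_of_lt ?_ hl
    rw [localEntropy]
    refine le_iSup_of_le μ ?_
    rw [iSup_pos hμ, iSup_pos hμg]
  obtain ⟨K, hK, hKcode⟩ := exists_orbitCodable_one (M := M) g hδ
  have hR1 : 1 ≤ R := by
    obtain ⟨ι, hι, c, hcard, -⟩ := hR
    exact (Fintype.card_pos_iff.2 ⟨c (Classical.arbitrary M)⟩).trans_le hcard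
  have hRpos : (0 : ℝ) < R := by exact_mod_cast hR1
  have hppos : (0 : ℝ) < p := by exact_mod_cast hp
  have key : ∀ s : ℝ, 0 < s → s < 1 / 4 →
      a ≤ Real.log R / p + l + 4 * s * Real.log (2 * K) := by
    intro s hs hs'
    have hσ : ENNReal.ofReal (1 - s) < 1 := by
      rw [ENNReal.ofReal_lt_one]
      linarith
    have hF := (le_iSup₂ (f := fun (σ : ℝ≥0∞) (_ : σ < 1) ↦ ⨅ (F : Set M) (_ : MeasurableSet F)
      (_ : σ ≤ μ F), localEntropyOn g F η) _ hσ).trans_lt hμl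
    simp only [iInf_lt_iff] at hF
    obtain ⟨F, hFm, hFμ, hFl⟩ := hF
    have hFne : F.Nonempty := by
      refine nonempty_of_measure_ne_zero (μ := μ) (ne_of_gt (lt_of_lt_of_le ?_ hFμ))
      exact ENNReal.ofReal_pos.2 (by linarith)
    -- The last term is the doubling of N, paid once per block of kp steps; it disappears as k → ∞.
    have hk : ∀ᶠ k : ℕ in atTop, a ≤ Real.log R / p + l + 4 * s * Real.log (2 * K) +
        Real.log 2 / p / k := by
      filter_upwards [eventually_orbitCodable_of_localEntropyOn_lt g.continuous hFne hFl hp hR hδ,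
        eventually_gt_atTop 0] with k hk hk0
      obtain ⟨U, N, hUo, hFU, hN, hNle, hNcode⟩ := hk
      have hkpos : (0 : ℝ) < k := by exact_mod_cast hk0
      have hq : 0 < k * p := Nat.mul_pos hk0 hp
      have hNpos : (0 : ℝ) < N := by exact_mod_cast hN
      -- Passing from 1 - s to 1 - 2s gives the strict inequality that survives weak convergence on
      -- open sets.
      have hUμ : ENNReal.ofReal (1 - 2 * s) < μ U := by
        refine lt_of_lt_of_le ?_ (hFμ.trans (measure_mono hFU))
        exact (ENNReal.ofReal_lt_ofReal_iff (by linarith)).2 (by linarith)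
      have h1 := le_of_frequently_exp_le (a := a) (s := 4 * s) hq hN hK (by
        refine (hμE U hUo _ hUμ).mono ?_
        rintro n ⟨hne, hn⟩
        obtain ⟨hnet, hexp⟩ := hEne n hne
        refine ⟨⌊4 * s * n⌋₊, Nat.floor_le (by positivity), hexp.trans ?_⟩
        obtain ⟨A, hAE, hA, hcard⟩ := exists_card_le_two_mul_badCount_le hUo.measurableSet hs hn
          (Nat.lt_floor_add_one (4 * s * n)).le
        have hcode := orbitCodable_badCount_le hq hN hK hNcode hKcode n (n / (k * p) + 1)
          ⌊4 * s * n⌋₊ (by rw [mul_comm]; exact (Nat.lt_mul_div_succ n hq).le)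
        have hAcard := card_le_of_orbitCodable hV (ENNReal.ofReal_pos.2 (by positivity)) hnet hcode
          hAE hA
        have := hcard.trans (Nat.mul_le_mul_left 2 hAcard)
        exact_mod_cast this)
      have h2 : Real.log (2 * N) ≤ Real.log 2 + (k * Real.log R + l * (k * p)) := by
        rw [Real.log_mul two_ne_zero hNpos.ne']
        have := Real.log_le_log hNpos hNle
        rw [Real.log_mul (by positivity) (Real.exp_pos _).ne', Real.log_pow, Real.log_exp] at this
        linarith
      push_cast at h1
      calc a ≤ _ := h1
        _ ≤ (Real.log 2 + (k * Real.log R + l * (k * p))) / (k * p) + 4 * s * Real.log (2 * K) := by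
            gcongr
        _ = _ := by field_simp; ring
    refine ge_of_tendsto ?_ hk
    simpa using (tendsto_const_nhds (x := Real.log R / p + l + 4 * s * Real.log (2 * K))).add
      (tendsto_const_div_atTop_nhds_zero_nat (Real.log 2 / p))
  have hlim : Tendsto (fun s : ℝ ↦ Real.log R / p + l + 4 * s * Real.log (2 * K)) (𝓝[>] 0)
      (𝓝 (Real.log R / p + l + 4 * 0 * Real.log (2 * K))) :=
    ((by fun_prop : Continuous fun s : ℝ ↦
      Real.log R / p + l + 4 * s * Real.log (2 * K)).tendsto 0).mono_left nhdsWithin_le_nhds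
  rw [mul_zero, zero_mul, add_zero] at hlim
  refine ge_of_tendsto hlim ?_
  filter_upwards [Ioo_mem_nhdsGT (show (0 : ℝ) < 1 / 4 by norm_num)] with s hs
  exact key s hs.1 hs.2

/-- The entropy splits into the entropy of a code at scale `η` and the local entropy at `η`. -/
theorem topEntropy_le_add_localEntropy [CompactSpace M] [Nonempty M] [MeasurableSpace M]
    [BorelSpace M] (g : C(M, M)) {η : ℝ} {p R : ℕ} (hp : 0 < p)
    (hR : OrbitCodable g univ p (ENNReal.ofReal η) R) :
    topEntropy g ≤ ((Real.log R / p : ℝ) : EReal) + localEntropy g η := by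
  refine EReal.le_of_forall_lt_iff_le.1 fun z hz ↦ ?_
  have hlt : localEntropy g η < ((z - Real.log R / p : ℝ) : EReal) := by
    generalize localEntropy (g : M → M) η = l at hz
    induction l with
    | bot => exact EReal.bot_lt_coe _
    | top => simp at hz
    | coe l =>
      norm_cast at hz ⊢
      linarith
  simpa using topEntropy_le_of_orbitCodable g hp hR hlt

/-- The errors satisfy e_(i+1) ≤ C e_i + ε, and C (C^i - 1) + 1 ≤ C^(i+1) - 1 exactly when C ≥ 2.
This is the role of the 2 in M_0(G). -/
theorem edist_iterate_le {f g : M → M} {C : NNReal} (hg : LipschitzWith C g) (hC : 2 ≤ C) {ε : ℝ}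
    (hε : 0 ≤ ε) (hgf : ∀ x, edist (g x) (f x) ≤ ENNReal.ofReal ε) (i : ℕ) (x : M) :
    edist (g^[i] x) (f^[i] x) ≤ ENNReal.ofReal (ε * (C ^ i - 1)) := by
  have hC' : (2 : ℝ) ≤ C := by exact_mod_cast hC
  induction i with
  | zero => simp
  | succ i ih =>
    have h1 : (1 : ℝ) ≤ C ^ i := one_le_pow₀ (by linarith)
    rw [Function.iterate_succ_apply', Function.iterate_succ_apply']
    calc edist (g (g^[i] x)) (f (f^[i] x))
        ≤ edist (g (g^[i] x)) (g (f^[i] x)) + edist (g (f^[i] x)) (f (f^[i] x)) :=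
          edist_triangle _ _ _
      _ ≤ ENNReal.ofReal C * ENNReal.ofReal (ε * (C ^ i - 1)) + ENNReal.ofReal ε := by
          refine add_le_add ((hg _ _).trans ?_) (hgf _)
          rw [ENNReal.ofReal_coe_nnreal]
          gcongr
      _ = ENNReal.ofReal (C * (ε * (C ^ i - 1)) + ε) := by
          have : 0 ≤ ε * ((C : ℝ) ^ i - 1) := mul_nonneg hε (by linarith)
          rw [← ENNReal.ofReal_mul (by positivity), ← ENNReal.ofReal_add (by positivity) hε]
      _ ≤ _ := by
          apply ENNReal.ofReal_le_ofReal
          rw [pow_succ]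
          nlinarith

/-- Codes for `f` are codes for its perturbations, at a larger scale. -/
theorem OrbitCodable.of_edist_le {f g : M → M} {C : NNReal} (hg : LipschitzWith C g) (hC : 2 ≤ C)
    {ε η : ℝ} (hε : 0 ≤ ε) (hgf : ∀ x, edist (g x) (f x) ≤ ENNReal.ofReal ε) {p R : ℕ}
    (hη : ε ≤ η / 4 * ((C : ℝ) ^ p)⁻¹)
    (hR : OrbitCodable f univ p (ENNReal.ofReal (2 * (η / 4))) R) :
    OrbitCodable g univ p (ENNReal.ofReal η) R := by
  obtain ⟨ι, hι, c, hcard, hc⟩ := hR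
  refine ⟨ι, hι, c, hcard, fun x hx y hy hxy i hi ↦ ?_⟩
  have hC' : (2 : ℝ) ≤ C := by exact_mod_cast hC
  have hCp : (0 : ℝ) < (C : ℝ) ^ p := by positivity
  rw [← div_eq_mul_inv, le_div_iff₀ hCp] at hη
  have hη0 : 0 ≤ η := by nlinarith
  -- Two errors of η/4 and the scale η/2 of the code for f add up to η.
  have hle : ∀ z, edist (g^[i] z) (f^[i] z) ≤ ENNReal.ofReal (η / 4) := by
    intro z
    refine (edist_iterate_le hg hC hε hgf i z).trans (ENNReal.ofReal_le_ofReal ?_)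
    have : (C : ℝ) ^ i ≤ C ^ p := pow_le_pow_right₀ (by linarith) hi.le
    nlinarith
  calc edist (g^[i] x) (g^[i] y)
      ≤ edist (g^[i] x) (f^[i] x) + edist (f^[i] x) (f^[i] y) + edist (f^[i] y) (g^[i] y) :=
        edist_triangle4 _ _ _ _
    _ < ENNReal.ofReal (η / 4) + ENNReal.ofReal (2 * (η / 4)) + ENNReal.ofReal (η / 4) := by
        refine ENNReal.add_lt_add_of_lt_of_le ?_ ?_ ?_
        · rw [edist_comm]
          exact ((hle y).trans_lt ENNReal.ofReal_lt_top).ne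
        · exact ENNReal.add_lt_add_of_le_of_lt ((hle x).trans_lt ENNReal.ofReal_lt_top).ne (hle x)
            (hc x hx y hy hxy i hi)
        · rw [edist_comm]
          exact hle y
    _ = ENNReal.ofReal η := by
        rw [← ENNReal.ofReal_add (by positivity) (by positivity),
          ← ENNReal.ofReal_add (by positivity) (by positivity)]
        ring_nf

end Estimate

/-! ### The times p_η and the resulting bound. -/

section Times

variable {M : Type*} [EMetricSpace M]

theorem scaleEntropy_ne_top [CompactSpace M] (f : M → M) {ε : ℝ} (hε : 0 < ε) :
    scaleEntropy f ε ≠ ⊤ :=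
  (Dynamics.coverEntropyEntourage_finite_of_isCompact_invariant isCompact_univ (mapsTo_univ f univ)
    (near_mem_uniformity hε)).ne

theorem scaleEntropy_ne_bot [Nonempty M] (f : M → M) (ε : ℝ) : scaleEntropy f ε ≠ ⊥ :=
  (EReal.bot_lt_zero.trans_le
    (Dynamics.coverEntropyEntourage_nonneg f univ_nonempty (near M ε))).ne'

theorem scaleEntropy_le_topEntropy (f : M → M) {ε : ℝ} (hε : 0 < ε) :
    scaleEntropy f ε ≤ topEntropy f :=
  Dynamics.coverEntropyEntourage_le_coverEntropy f univ (near_mem_uniformity hε)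

variable [CompactSpace M] [Nonempty M]

/-- The whole space has an optimal code by dynamical balls. -/
theorem exists_orbitCodable_log_spanCard (f : M → M) {ε : ℝ} (hε : 0 < ε) (n : ℕ) :
    ∃ R : ℕ, OrbitCodable f univ n (ENNReal.ofReal (2 * ε)) R ∧
      ENNReal.log (spanCard f univ ε n) = (Real.log R : EReal) := by
  obtain ⟨t, ht, hcard⟩ := (Dynamics.coverMincard_finite_iff f univ (near M ε) n).1
    (Dynamics.coverMincard_finite_of_isCompact_invariant isCompact_univ (mapsTo_univ f univ)
      (near_mem_uniformity hε) n)
  have hne : t.Nonempty := by simpa using ht.nonempty univ_nonempty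
  refine ⟨t.card, (orbitCodable_biUnion_dynBall f n hε.le hne).mono_set ?_, ?_⟩
  · simpa using isDynCoverOf_near_iff.1 ht
  · rw [spanCard, ← hcard, ENat.toENNReal_coe, ← ENNReal.ofReal_natCast,
      ENNReal.log_ofReal_of_pos (by exact_mod_cast hne.card_pos)]

/-- As h(f, η/4) is finite, adding a positive amount makes it strictly larger, and a sequence is
eventually below any number above its limsup. -/
theorem goodTimes_nonempty [MeasurableSpace M] (f : C(M, M)) (G : Set C(M, M)) {η : ℝ}
    (hη : 0 < η) (hG : 0 < localEntropySup G η) : (goodTimes f G η).Nonempty := by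
  have hη' : 0 < η / 4 := by positivity
  have hlt : scaleEntropy f (η / 4) < localEntropySup G η + scaleEntropy f (η / 4) := by
    have h1 := scaleEntropy_ne_top f hη'
    have h2 := scaleEntropy_ne_bot (f : M → M) (η / 4)
    simpa using EReal.add_lt_add_of_lt_of_le hG le_rfl h2 h1
  have h := eventually_lt_of_limsup_lt hlt
  obtain ⟨p, hp, hp1⟩ := (h.and (eventually_ge_atTop 1)).exists
  refine ⟨p, hp1, EReal.sub_le_of_le_add ?_⟩
  exact hp.le

theorem log_div_le_of_mem_goodTimes [MeasurableSpace M] {f : C(M, M)} {G : Set C(M, M)} {η : ℝ}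
    (hη : 0 < η) {p : ℕ} (hp : p ∈ goodTimes f G η) :
    ENNReal.log (spanCard f univ (η / 4) p) / (p : EReal) ≤
      localEntropySup G η + topEntropy f := by
  have hη' : 0 < η / 4 := by positivity
  have h := (EReal.sub_le_iff_le_add (.inl (scaleEntropy_ne_bot _ _))
    (.inl (scaleEntropy_ne_top _ hη'))).1 hp.2
  exact h.trans (add_le_add_right (scaleEntropy_le_topEntropy f hη') _)

/-- One h_loc^G(η) bounds the excess of the code's rate over h(f); the other bounds the entropy of g
below the scale η. -/
theorem topEntropy_le_of_lipschitzWith [MeasurableSpace M] [BorelSpace M] (f : C(M, M))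
    {G : Set C(M, M)} {g : C(M, M)} (hgG : g ∈ G) {C : NNReal} (hC : 2 ≤ C)
    (hg : LipschitzWith C g) {ε η : ℝ} (hε : 0 ≤ ε) (hη : 0 < η)
    (hgf : ∀ x, edist (g x) (f x) ≤ ENNReal.ofReal ε) {p : ℕ} (hp : p ∈ goodTimes f G η)
    (hεp : ε ≤ η / 4 * ((C : ℝ) ^ p)⁻¹) :
    topEntropy g ≤ topEntropy f + 2 * localEntropySup G η := by
  obtain ⟨R, hR, hlog⟩ := exists_orbitCodable_log_spanCard f (by positivity : 0 < η / 4) p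
  have h1 := topEntropy_le_add_localEntropy g hp.1 (hR.of_edist_le hg hC hε hgf hεp)
  have h2 := log_div_le_of_mem_goodTimes hη hp
  rw [hlog] at h2
  have h3 : ((Real.log R / p : ℝ) : EReal) = (Real.log R : EReal) / (p : EReal) := by
    rw [EReal.coe_div]
    rfl
  have h4 : localEntropy g η ≤ localEntropySup G η :=
    le_iSup₂ (f := fun (g : C(M, M)) (_ : g ∈ G) ↦ localEntropy g η) g hgG
  have h5 : 2 * localEntropySup G η = localEntropySup G η + localEntropySup G η := by
    generalize localEntropySup G η = l
    induction l with
    | bot => simp [EReal.mul_bot_of_pos]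
    | top => simp [EReal.mul_top_of_pos]
    | coe l =>
      rw [show (2 : EReal) = ((2 : ℝ) : EReal) from rfl, ← EReal.coe_mul, ← EReal.coe_add, two_mul]
  rw [h5, ← add_assoc, add_comm (topEntropy f)]
  exact h1.trans (add_le_add (h3.trans_le h2) h4)

end Times

end LocalEntropy

theorem mainTheorem12
    {E : Type*} [NormedAddCommGroup E] [NormedSpace ℝ E] [FiniteDimensional ℝ E]
    {H : Type*} [TopologicalSpace H] (I : ModelWithCorners ℝ E H)
    {M : Type*} [EMetricSpace M] [CompactSpace M] [Nonempty M]
    [MeasurableSpace M] [BorelSpace M]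
    [ChartedSpace H M] [IsManifold I ∞ M]
    [RiemannianBundle (fun x : M ↦ TangentSpace I x)]
    [IsContMDiffRiemannianBundle I ∞ E (fun x : M ↦ TangentSpace I x)]
    [IsRiemannianManifold I M]
    (f : C(M, M)) (G : Set C(M, M))
    (hloc : Tendsto (LocalEntropy.localEntropySup G) (𝓝[>] 0) (𝓝 0))
    (hdiff : ∀ g ∈ G, MDifferentiable I I g)
    (hbound : LocalEntropy.derivBound I G < ⊤) :
    -- the integer attached to a scale exists as soon as the local entropy at it is positive
    (∀ η : ℝ, 0 < η → 0 < LocalEntropy.localEntropySup G η →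
      (LocalEntropy.goodTimes f G η).Nonempty) ∧
    -- the estimate at an exact inverse value
    (∀ ε : ℝ, 0 < ε → ∀ N : ℝ,
      IsLeast {η : ℝ | 0 < η ∧ LocalEntropy.closeness I f G η = ε} N →
      ∀ g ∈ G, (⨆ x : M, edist (g x) (f x)) ≤ ENNReal.ofReal ε →
        LocalEntropy.topEntropy g ≤
          LocalEntropy.topEntropy f + 2 * LocalEntropy.localEntropySup G N) ∧
    -- the estimate at every scale that allows the given distance
    (∀ ε : ℝ, 0 < ε → ∀ η : ℝ, 0 < η → ε ≤ LocalEntropy.closeness I f G η →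
      ∀ g ∈ G, (⨆ x : M, edist (g x) (f x)) ≤ ENNReal.ofReal ε →
        LocalEntropy.topEntropy g ≤
          LocalEntropy.topEntropy f + 2 * LocalEntropy.localEntropySup G η) := by
  have key : ∀ ε : ℝ, 0 < ε → ∀ η : ℝ, 0 < η → ε ≤ LocalEntropy.closeness I f G η →
      ∀ g ∈ G, (⨆ x : M, edist (g x) (f x)) ≤ ENNReal.ofReal ε →
        LocalEntropy.topEntropy g ≤
          LocalEntropy.topEntropy f + 2 * LocalEntropy.localEntropySup G η := by
    intro ε hε η hη hεη g hg hgf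
    -- Positivity of ε rules out the default value 0 of `closeness`, so p_η is a genuine minimum.
    have hne : (LocalEntropy.goodTimes f G η).Nonempty := by
      by_contra h
      rw [LocalEntropy.closeness, if_neg h] at hεη
      linarith
    rw [LocalEntropy.closeness, if_pos hne] at hεη
    have hmax : max (⨆ x : M, ‖mfderiv I I g x‖ₑ) 2 ≤ LocalEntropy.derivBound I G :=
      le_iSup₂ (f := fun (g : C(M, M)) (_ : g ∈ G) ↦ max (⨆ x : M, ‖mfderiv I I g x‖ₑ) 2) g hg
    lift LocalEntropy.derivBound I G to NNReal using hbound.ne with C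
    have hC : 2 ≤ C := by exact_mod_cast (le_max_right _ _).trans hmax
    have : IsContinuousRiemannianBundle E (fun x : M ↦ TangentSpace I x) := by
      obtain ⟨m, hm, h⟩ := IsContMDiffRiemannianBundle.exists_contMDiff (IB := I) (n := ∞) (F := E)
        (E := fun x : M ↦ TangentSpace I x)
      exact ⟨m, hm.continuous, h⟩
    have hlip : LipschitzWith C g := LocalEntropy.lipschitzWith_of_enorm_mfderiv_le I (hdiff g hg)
      (by positivity) fun x ↦ (le_iSup (fun x : M ↦ ‖mfderiv I I g x‖ₑ) x).trans
        ((le_max_left _ _).trans hmax)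
    exact LocalEntropy.topEntropy_le_of_lipschitzWith f hg hC hlip hε.le hη
      (fun x ↦ (le_iSup (fun x ↦ edist (g x) (f x)) x).trans hgf) (Nat.sInf_mem hne) hεη
  exact ⟨fun η hη ↦ LocalEntropy.goodTimes_nonempty f G hη,
    -- An exact inverse value is the case of equality in ε ≤ δ(η).
    fun ε hε N hN ↦ key ε hε N hN.1.1 hN.1.2.ge, key⟩
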